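/- Let $\mathcal X,\mathcal Y$ be finite alphabets, let $P(y|x)$ be the transition probabilities of a discrete memoryless channel, and let $P(x)$ be a probability distribution on $\mathcal X$ such that every $y\in\mathcal Y$ has positive probability $\sum_x P(x)P(y|x)$. Assume that for every real $s$ $$\gamma_y(s)=-\ln\Big[\sum_{x\in\mathcal X}P(x)P(y|x)^s\Big]$$ does not depend on $y$ (if some $P(y|x)$ vanish, we put $0^0=1$ and $0^s=0$ for $s<0$), and write $\gamma(s)$ for it. Let $R\ge 0$ and $T\ge 0$, and let $s_R\ge 0$ be a solution of $\gamma(s)-s\gamma'(s)=R$. For $s\ge 0$ let $$E_1^*(R,T,s)=\Lambda(R,s)+\gamma(1-s)-sT-\ln|\mathcal Y|,\qquad \Lambda(R,s)=\begin{cases}\gamma(s)-R,& s\ge s_R,\\ s\,\gamma'(s_R),& s<s_R,\end{cases}$$ and $E_1^*(R,T)=\sup_{s\ge0}E_1^*(R,T,s)$, $E_2^*(R,T)=E_1^*(R,T)+T$. For each block length $n$, draw $M=M_n\ge 1$ codewords $\mathbf x_1,\dots,\mathbf x_M\in\mathcal X^n$ independently with i.i.d. letters of law $P(x)$, where $\frac1n\ln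 M_n\to R$ (for instance $M_n=\lceil e^{nR}\rceil$), and use Forney's optimal erasure decoder with threshold $T$, whose decision regions are $$\mathcal R_m^*=\Big\{\mathbf y\in\mathcal Y^n:\ P(\mathbf y|\mathbf x_m)\ge e^{nT}\sum_{m'\ne m}P(\mathbf y|\mathbf x_{m'})\Big\},\qquad P(\mathbf y|\mathbf x)=\prod_{i=1}^nP(y_i|x_i).$$ Let $\overline{\Pr}\{\mathcal E_1\}$ and $\overline{\Pr}\{\mathcal E_2\}$ be the averages, over the random choice of the code, of $$\Pr\{\mathcal E_1\}=\frac1M\sum_{m}\sum_{\mathbf y\notin\mathcal R_m^*}P(\mathbf y|\mathbf x_m),\qquad \Pr\{\mathcal E_2\}=\frac1M\sum_{m}\sum_{\mathbf y\in\mathcal R_m^*}\sum_{m'\ne m}P(\mathbf y|\mathbf x_{m'}),$$ the probabilities of not making the right decision and of an undetected error. Then $E_1^*(R,T)$ is finite and, to exponential order, $$\overline{\Pr}\{\mathcal E_1\}\ \dot\le\ e^{-nE_1^*(R,T)},\qquad \overline{\Pr}\{\mathcal E_2\}\ \dot\le\ e^{-nE_2^*(R,T)},$$ where $a_n\,\dot\le\,b_n$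 means $\limsup_{n\to\infty}\frac1n\ln\frac{a_n}{b_n}\le0$ (with $\ln 0=-\infty$). Moreover $E_1^*(R,T)\ge E_1(R,T)$, where $$E_1(R,T)=\sup_{0\le s\le\rho\le1}\big[E_0(s,\rho)-\rho R-sT\big],\quad E_0(s,\rho)=-\ln\Big[\sum_y\Big(\sum_xP(x)P(y|x)^{1-s}\Big)\Big(\sum_{x'}P(x')P(y|x')^{s/\rho}\Big)^{\rho}\Big]$$ is Forney's exponent (a finite supremum; for $s=\rho=0$, $s/\rho$ is read as $0$, so that $E_0(0,0)=0$). -/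

import Mathlib

open Filter Topology

noncomputable section

namespace ErasureCoding

/-- `a n ≤ b n` to exponential order: `limsup (1/n) ln (a n / b n) ≤ 0`, where `ln 0 = -∞`
(extended-real logarithm, since an error probability may vanish). -/
def ExpLE (a b : ℕ → ℝ) : Prop :=
  limsup (fun n : ℕ =>
    (((1 / (n : ℝ)) : ℝ) : EReal) * ENNReal.log (ENNReal.ofReal (a n / b n))) atTop ≤ 0

section Coding

variable {X Y : Type*} [Fintype X] [Fintype Y]

/-- Memoryless channel: `P(𝐲|𝐱) = ∏ᵢ P(yᵢ|xᵢ)`, with `W x y = P(y|x)`. -/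
def blockLaw (W : X → Y → ℝ) {n : ℕ} (x : Fin n → X) (y : Fin n → Y) : ℝ :=
  ∏ i, W (x i) (y i)

/-- `∑_{m' ≠ m} P(𝐲|𝐱_{m'})` for the code `C`. -/
def competitors (W : X → Y → ℝ) {n M : ℕ} (C : Fin M → Fin n → X) (m : Fin M)
    (y : Fin n → Y) : ℝ :=
  ∑ m' ∈ Finset.univ.erase m, blockLaw W (C m') y

/-- The decision region of message `m` of the optimal erasure decoder with threshold `T`:
the likelihood of `m` is at least `e^{nT}` times the sum of the other likelihoods.
(The ratio test is cleared of its denominator, which may be zero.) -/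
def decisionRegion (W : X → Y → ℝ) (T : ℝ) {n M : ℕ} (C : Fin M → Fin n → X) (m : Fin M) :
    Set (Fin n → Y) :=
  {y | Real.exp (n * T) * competitors W C m y ≤ blockLaw W (C m) y}

/-- Probability of not making the right decision, for the code `C` and equiprobable messages. -/
def prE1 (W : X → Y → ℝ) (T : ℝ) {n M : ℕ} (C : Fin M → Fin n → X) : ℝ :=
  (1 / (M : ℝ)) * ∑ m, ∑ y, (decisionRegion W T C m)ᶜ.indicator (blockLaw W (C m)) y

/-- Probability of an undetected error, for the code `C` and equiprobable messages. -/
def prE2 (W : X → Y → ℝ) (T : ℝ) {n M : ℕ} (C : Fin M → Fin n → X) : ℝ :=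
  (1 / (M : ℝ)) * ∑ m, ∑ y, (decisionRegion W T C m).indicator (competitors W C m) y

/-- Average of `f` over the ensemble of codes with `M` independent codewords of length `n`,
each with i.i.d. letters of law `P`. -/
def codeAverage (P : X → ℝ) {n M : ℕ} (f : (Fin M → Fin n → X) → ℝ) : ℝ :=
  ∑ C : Fin M → Fin n → X, (∏ m, ∏ i, P (C m i)) * f C

/-- `γ_y(s) = -ln ∑_x P(x) P(y|x)^s`. The real power has `0 ^ 0 = 1` and `0 ^ s = 0` for `s < 0`,
so for `s < 0` the sum runs over the `x` with `P(y|x) > 0`. -/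
def gammaAt (P : X → ℝ) (W : X → Y → ℝ) (y : Y) (s : ℝ) : ℝ :=
  -Real.log (∑ x, P x * W x y ^ s)

/-- Forney's function
`E₀(s,ρ) = -ln ∑_y (∑_x P(x) P(y|x)^{1-s}) (∑_x' P(x') P(y|x')^{s/ρ})^ρ`. -/
def forneyE0 (P : X → ℝ) (W : X → Y → ℝ) (s ρ : ℝ) : ℝ :=
  -Real.log (∑ y, (∑ x, P x * W x y ^ (1 - s)) * (∑ x, P x * W x y ^ (s / ρ)) ^ ρ)

/-- The values `E₀(s,ρ) - ρR - sT`, `0 ≤ s ≤ ρ ≤ 1`, over which Forney maximizes. -/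
def forneyValues (P : X → ℝ) (W : X → Y → ℝ) (R T : ℝ) : Set ℝ :=
  {e | ∃ s ρ : ℝ, 0 ≤ s ∧ s ≤ ρ ∧ ρ ≤ 1 ∧ e = forneyE0 P W s ρ - ρ * R - s * T}

/-- Forney's exponent `E₁(R,T)`. -/
def forneyE1 (P : X → ℝ) (W : X → Y → ℝ) (R T : ℝ) : ℝ :=
  sSup (forneyValues P W R T)

end Coding

section Exponent

/-- `Λ(R,s)`, with `sR` the solution of `γ(s) - s γ'(s) = R`. -/
def Lam (γ : ℝ → ℝ) (sR R s : ℝ) : ℝ :=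
  if sR ≤ s then γ s - R else s * deriv γ sR

/-- `E₁*(R,T,s) = Λ(R,s) + γ(1-s) - sT - ln|𝒴|`. -/
def starAt (Y : Type*) [Fintype Y] (γ : ℝ → ℝ) (sR R T s : ℝ) : ℝ :=
  Lam γ sR R s + γ (1 - s) - s * T - Real.log (Fintype.card Y)

/-- The values `E₁*(R,T,s)`, `s ≥ 0`. -/
def starValues (Y : Type*) [Fintype Y] (γ : ℝ → ℝ) (sR R T : ℝ) : Set ℝ :=
  starAt Y γ sR R T '' Set.Ici 0

/-- `E₁*(R,T) = sup_{s ≥ 0} E₁*(R,T,s)`. -/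
def starE1 (Y : Type*) [Fintype Y] (γ : ℝ → ℝ) (sR R T : ℝ) : ℝ :=
  sSup (starValues Y γ sR R T)

/-- `E₂*(R,T) = E₁*(R,T) + T`. -/
def starE2 (Y : Type*) [Fintype Y] (γ : ℝ → ℝ) (sR R T : ℝ) : ℝ :=
  starE1 Y γ sR R T + T

end Exponent

end ErasureCoding

end

/-! ### Hölder's inequality and concavity of `γ` -/

namespace ErasureCoding

/-! The starred exponent is Forney's exponent with the maximum over ρ carried out, so Forney's
random-coding bound suffices.

Since the sums over inputs do not depend on y, E₀(s,ρ) = γ(1-s) + ργ(s/ρ) - ln|𝒴| (`forneyE0_eq`).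
With s > 0 fixed and σ = s/ρ, the part depending on ρ is s(γ(σ) - R)/σ, that is, s times the slope
of the chord from (0,R) to the graph of γ. By concavity the best σ is s_R, where the tangent passes
through (0,R), and if s exceeds s_R the best choice is ρ = 1; the maximum is Λ(R,s)
(`mul_sub_rate_le_Lam`). Dropping Forney's constraints σ ≤ 1 and s ≤ 1 gains nothing
(`exists_forneyValues_ge`): for s_R ≥ 1 every starred value is at most 0, and otherwise s > 1 is no
better than max(s_R, 1/2). The convention 0⁰ = 1 may make γ jump at 0, hence `JumpConcave`.

For the coding bound, both error terms are dominated by P(𝐲|𝐱_m)^{1-s} times the s-th power of the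
competitors' sum, with an extra e^{-nT} for the undetected error; `sum_codebook_competitors_rpow_le`
averages this over codes. -/

theorem sum_rpow_mul_rpow_le {ι : Type*} (S : Finset ι) (a b : ι → ℝ) (ha : ∀ i ∈ S, 0 ≤ a i)
    (hb : ∀ i ∈ S, 0 ≤ b i) {t : ℝ} (h0 : 0 ≤ t) (h1 : t ≤ 1) :
    ∑ i ∈ S, a i ^ (1 - t) * b i ^ t ≤ (∑ i ∈ S, a i) ^ (1 - t) * (∑ i ∈ S, b i) ^ t := by
  -- At the endpoints one of the conjugate exponents would be infinite.
  rcases h0.eq_or_lt with rfl | h0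
  · simp
  rcases h1.eq_or_lt with rfl | h1
  · simp
  have h1' : 0 < 1 - t := by linarith
  have hpq : Real.HolderConjugate (1 - t)⁻¹ t⁻¹ := by
    rw [Real.holderConjugate_iff]
    refine ⟨(one_lt_inv₀ h1').2 (by linarith), by simp⟩
  have := Real.inner_le_Lp_mul_Lq_of_nonneg S (f := fun i => a i ^ (1 - t))
    (g := fun i => b i ^ t) hpq (fun i hi => Real.rpow_nonneg (ha i hi) _)
    (fun i hi => Real.rpow_nonneg (hb i hi) _)
  refine this.trans_eq ?_
  have e1 : ∀ i ∈ S, (a i ^ (1 - t)) ^ (1 - t)⁻¹ = a i := fun i hi =>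
    Real.rpow_rpow_inv (ha i hi) h1'.ne'
  have e2 : ∀ i ∈ S, (b i ^ t) ^ t⁻¹ = b i := fun i hi =>
    Real.rpow_rpow_inv (hb i hi) h0.ne'
  rw [Finset.sum_congr rfl e1, Finset.sum_congr rfl e2]
  simp

/-- Strict positivity of `p` matters for the empty sum, where `0 ^ 0 = 1`. -/
theorem rpow_sum_le_sum_rpow {ι : Type*} (S : Finset ι) (f : ι → ℝ) (hf : ∀ i ∈ S, 0 ≤ f i)
    {p : ℝ} (h0 : 0 < p) (h1 : p ≤ 1) : (∑ i ∈ S, f i) ^ p ≤ ∑ i ∈ S, f i ^ p := by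
  classical
  induction S using Finset.induction_on with
  | empty => simp [Real.zero_rpow h0.ne']
  | insert a S ha ih =>
    rw [Finset.sum_insert ha, Finset.sum_insert ha]
    refine (Real.rpow_add_le_add_rpow (hf a (by simp))
      (Finset.sum_nonneg fun i hi => hf i (by simp [hi])) h0.le h1).trans ?_
    gcongr
    exact ih fun i hi => hf i (by simp [hi])

/-- Hölder's inequality makes the sum of exponentials log-convex: the weighted geometric mean of the
terms at u and v is the term at the intermediate point. -/
theorem concaveOn_neg_log_sum_exp {ι : Type*} (S : Finset ι) (p l : ι → ℝ)
    (hp : ∀ i ∈ S, 0 ≤ p i) (hS : ∃ i ∈ S, 0 < p i) :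
    ConcaveOn ℝ Set.univ fun s : ℝ => -Real.log (∑ i ∈ S, p i * Real.exp (s * l i)) := by
  have pos : ∀ s : ℝ, 0 < ∑ i ∈ S, p i * Real.exp (s * l i) := fun s => by
    obtain ⟨i, hi, h⟩ := hS
    exact Finset.sum_pos' (fun j hj => mul_nonneg (hp j hj) (Real.exp_pos _).le)
      ⟨i, hi, mul_pos h (Real.exp_pos _)⟩
  refine ⟨convex_univ, fun u _ v _ a b ha hb hab => ?_⟩
  obtain rfl : a = 1 - b := by linarith
  have key := sum_rpow_mul_rpow_le S (fun i => p i * Real.exp (u * l i))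
    (fun i => p i * Real.exp (v * l i)) (fun j hj => mul_nonneg (hp j hj) (Real.exp_pos _).le)
    (fun j hj => mul_nonneg (hp j hj) (Real.exp_pos _).le) hb (by linarith)
  have e : ∀ i ∈ S, (p i * Real.exp (u * l i)) ^ (1 - b) * (p i * Real.exp (v * l i)) ^ b
      = p i * Real.exp (((1 - b) * u + b * v) * l i) := fun i hi => by
    rw [Real.mul_rpow (hp i hi) (Real.exp_pos _).le, Real.mul_rpow (hp i hi) (Real.exp_pos _).le,
      ← Real.exp_mul, ← Real.exp_mul, mul_mul_mul_comm, ← Real.exp_add,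
      ← Real.rpow_add' (hp i hi) (by simp)]
    simp only [sub_add_cancel, Real.rpow_one]
    ring_nf
  rw [Finset.sum_congr rfl e] at key
  have := Real.log_le_log (pos _) key
  rw [Real.log_mul (Real.rpow_pos_of_pos (pos u) _).ne' (Real.rpow_pos_of_pos (pos v) _).ne',
    Real.log_rpow (pos u), Real.log_rpow (pos v)] at this
  simp only [smul_eq_mul]
  linarith

theorem differentiable_neg_log_sum_exp {ι : Type*} (S : Finset ι) (p l : ι → ℝ)
    (hp : ∀ i ∈ S, 0 ≤ p i) (hS : ∃ i ∈ S, 0 < p i) :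
    Differentiable ℝ fun s : ℝ => -Real.log (∑ i ∈ S, p i * Real.exp (s * l i)) := by
  have pos : ∀ s : ℝ, 0 < ∑ i ∈ S, p i * Real.exp (s * l i) := fun s => by
    obtain ⟨i, hi, h⟩ := hS
    exact Finset.sum_pos' (fun j hj => mul_nonneg (hp j hj) (Real.exp_pos _).le)
      ⟨i, hi, mul_pos h (Real.exp_pos _)⟩
  refine (Differentiable.log ?_ fun s => (pos s).ne').neg
  fun_prop

/-- Clearing denominators lets the points coincide and leaves a form suited to `nlinarith`. -/
theorem _root_.ConcaveOn.three_point {h : ℝ → ℝ} (hc : ConcaveOn ℝ Set.univ h) {a b c : ℝ}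
    (hab : a ≤ b) (hbc : b ≤ c) : (c - b) * h a + (b - a) * h c ≤ (c - a) * h b := by
  rcases (hab.trans hbc).eq_or_lt with hac | hac
  · obtain rfl : a = b := by linarith
    subst hac
    simp
  have hca : 0 < c - a := by linarith
  have hl : 0 ≤ (c - b) / (c - a) := div_nonneg (by linarith) hca.le
  have hr : 0 ≤ (b - a) / (c - a) := div_nonneg (by linarith) hca.le
  have := hc.2 (Set.mem_univ a) (Set.mem_univ c) hl hr (by field_simp; ring)
  have e : ((c - b) / (c - a)) • a + ((b - a) / (c - a)) • c = b := by
    simp only [smul_eq_mul]; field_simp; ring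
  rw [e] at this
  simp only [smul_eq_mul] at this
  have := mul_le_mul_of_nonneg_left this hca.le
  calc _ = (c - a) * ((c - b) / (c - a) * h a + (b - a) / (c - a) * h c) := by field_simp
    _ ≤ _ := this

theorem _root_.ConcaveOn.le_tangent {h : ℝ → ℝ} (hc : ConcaveOn ℝ Set.univ h) {x : ℝ}
    (hd : DifferentiableAt ℝ h x) (y : ℝ) : h y ≤ h x + deriv h x * (y - x) := by
  rcases lt_trichotomy y x with hyx | rfl | hxy
  · have := hc.deriv_le_slope (Set.mem_univ y) (Set.mem_univ x) hyx hd
    rw [slope_def_field, le_div_iff₀ (by linarith)] at this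
    linarith
  · simp
  · have := hc.slope_le_deriv (Set.mem_univ x) (Set.mem_univ y) hxy hd
    rw [slope_def_field, div_le_iff₀ (by linarith)] at this
    linarith

/-- `γ` is the concave differentiable function `h` with a possible downward jump at `0`;
`h` restricts the defining sum to the inputs of positive transition probability. -/
theorem exists_concave_eq_gammaAt {X Y : Type*} [Fintype X] (P : X → ℝ)
    (hP : ∀ x, 0 ≤ P x) (hP1 : ∑ x, P x = 1) (W : X → Y → ℝ) (hW : ∀ x y, 0 ≤ W x y) (y : Y)
    (hpos : ∃ x, 0 < P x ∧ 0 < W x y) :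
    ∃ h : ℝ → ℝ, ConcaveOn ℝ Set.univ h ∧ Differentiable ℝ h ∧
      (∀ s, s ≠ 0 → gammaAt P W y s = h s) ∧ 0 ≤ h 0 := by
  classical
  let S : Finset X := Finset.univ.filter fun x => 0 < W x y
  have hS : ∃ x ∈ S, 0 < P x := by
    obtain ⟨x, h1, h2⟩ := hpos
    exact ⟨x, by simp [S, h2], h1⟩
  refine ⟨_, concaveOn_neg_log_sum_exp S P (fun x => Real.log (W x y)) (fun i _ => hP i) hS,
    differentiable_neg_log_sum_exp S P (fun x => Real.log (W x y)) (fun i _ => hP i) hS, ?_, ?_⟩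
  · intro s hs
    rw [gammaAt]
    congr 2
    rw [Finset.sum_filter]
    refine Finset.sum_congr rfl fun x _ => ?_
    split_ifs with hx
    · rw [Real.rpow_def_of_pos hx, mul_comm s]
    · rw [le_antisymm (not_lt.1 hx) (hW x y), Real.zero_rpow hs, mul_zero]
  -- At 0 the restricted sum is the P-mass of the inputs that can produce y.
  · have : ∑ x ∈ S, P x ≤ 1 := hP1 ▸
      Finset.sum_le_sum_of_subset_of_nonneg (Finset.subset_univ S) fun x _ _ => hP x
    simpa using Real.log_nonpos (Finset.sum_nonneg fun x _ => hP x) this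

end ErasureCoding
-- Geometry of the exponent: tangent and chord bounds
namespace ErasureCoding

/-- `γ` agrees off `0` with the concave differentiable `h`, and vanishes at `0`. -/
structure JumpConcave (γ h : ℝ → ℝ) : Prop where
  concave : ConcaveOn ℝ Set.univ h
  differentiable : Differentiable ℝ h
  eq_of_ne : ∀ s, s ≠ 0 → γ s = h s
  nonneg_zero : 0 ≤ h 0
  zero : γ 0 = 0

namespace JumpConcave

variable {γ h : ℝ → ℝ} {sR R : ℝ}

theorem le (H : JumpConcave γ h) (s : ℝ) : γ s ≤ h s := by
  rcases eq_or_ne s 0 with rfl | hs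
  · rw [H.zero]; exact H.nonneg_zero
  · exact (H.eq_of_ne s hs).le

theorem deriv_eq (H : JumpConcave γ h) {s : ℝ} (hs : s ≠ 0) : deriv γ s = deriv h s :=
  Filter.EventuallyEq.deriv_eq
    (Filter.mem_of_superset (isOpen_ne.mem_nhds hs) fun t ht => H.eq_of_ne t ht)

/-- The equation for `sR` says that the tangent at `sR` passes through (0,R), and a concave graph
lies below its tangents. -/
theorem sub_rate_le (H : JumpConcave γ h) (hsR : 0 < sR)
    (hsol : γ sR - sR * deriv γ sR = R) (s : ℝ) : h s - R ≤ s * deriv γ sR := by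
  have := H.concave.le_tangent (H.differentiable sR) s
  rw [← H.deriv_eq hsR.ne', ← H.eq_of_ne sR hsR.ne'] at this
  linarith

theorem Lam_le (H : JumpConcave γ h) (hsR : 0 < sR)
    (hsol : γ sR - sR * deriv γ sR = R) (s : ℝ) : Lam γ sR R s ≤ s * deriv γ sR := by
  unfold Lam
  split_ifs
  · exact (sub_le_sub_right (H.le s) R).trans (H.sub_rate_le hsR hsol s)
  · rfl

/-- The chord bound `s (γ(σ) - R) / σ ≤ Λ(R, s)` for `0 < s ≤ σ`, with `ρ = s / σ`. -/
theorem mul_sub_rate_le_Lam (H : JumpConcave γ h) (hsR : 0 ≤ sR)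
    (hsol : γ sR - sR * deriv γ sR = R) {ρ σ : ℝ} (hρ : 0 < ρ) (hρ1 : ρ ≤ 1) (hσ : 0 < σ) :
    ρ * (γ σ - R) ≤ Lam γ sR R (ρ * σ) := by
  have hs : 0 < ρ * σ := mul_pos hρ hσ
  have hsσ : ρ * σ ≤ σ := by nlinarith
  unfold Lam
  rw [H.eq_of_ne σ hσ.ne', H.eq_of_ne _ hs.ne']
  rcases hsR.eq_or_lt with rfl | hsR
  -- The factor `sR = 0` removes the derivative, which need not exist at the jump.
  · have hR : R = 0 := by rw [← hsol, H.zero]; simp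
    rw [if_pos hs.le, hR]
    have := H.concave.three_point hs.le hsσ
    have h1 : 0 ≤ (1 - ρ) * h 0 := mul_nonneg (by linarith) H.nonneg_zero
    have : σ * (ρ * h σ) ≤ σ * h (ρ * σ) := by nlinarith
    have := le_of_mul_le_mul_left this hσ
    linarith
  · split_ifs with hle
    · set s := ρ * σ with hsdef
      have hσR := H.sub_rate_le hsR hsol σ
      have htp := H.concave.three_point hle hsσ
      rw [← H.eq_of_ne sR hsR.ne', show γ sR = R + sR * deriv γ sR by linarith] at htp
      set D := deriv γ sR
      rcases (hle.trans hsσ).eq_or_lt with hEq | hlt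
      · have e : s = σ := le_antisymm hsσ (hEq ▸ hle)
        have : ρ = 1 := by
          have : ρ * σ = 1 * σ := by rw [← hsdef, e, one_mul]
          exact mul_right_cancel₀ hσ.ne' this
        rw [this, e, one_mul]
      · have hpos : 0 < σ - sR := by linarith
        refine le_of_mul_le_mul_left (a := σ - sR) ?_ hpos
        -- This product is exactly what remains of the three-point inequality after substituting `s
        -- = ρ * σ` and `h sR = R + sR * D`.
        have hk : 0 ≤ (sR * (1 - ρ)) * (σ * D - (h σ - R)) :=
          mul_nonneg (mul_nonneg hsR.le (by linarith)) (by linarith)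
        nlinarith
    · have := H.sub_rate_le hsR hsol σ
      calc ρ * (h σ - R) ≤ ρ * (σ * deriv γ sR) := mul_le_mul_of_nonneg_left this hρ.le
        _ = _ := by ring

/-- Beyond the larger of `s_R` and `1/2` the exponent function decreases. -/
theorem add_reflect_le (H : JumpConcave γ h) {u s : ℝ} (hu : 1 / 2 ≤ u) (hu1 : u < 1)
    (hus : u < s) : γ s + γ (1 - s) ≤ γ u + γ (1 - u) := by
  -- The function h(s) + h(1-s) is concave and symmetric about 1/2. Since `u < 1`, neither `u` nor
  -- `1 - u` is the jump point; at `s` and `1 - s` a jump only lowers the left side.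
  have h1 := H.concave.three_point (show 1 - s ≤ u by linarith) hus.le
  have h2 := H.concave.three_point (show 1 - s ≤ 1 - u by linarith) (show 1 - u ≤ s by linarith)
  rw [H.eq_of_ne u (by linarith), H.eq_of_ne (1 - u) (by linarith)]
  refine (add_le_add (H.le s) (H.le (1 - s))).trans ?_
  refine le_of_mul_le_mul_left (a := 2 * s - 1) ?_ (by linarith)
  nlinarith

/-- Above the mutual information the exponent vanishes. -/
theorem mul_deriv_add_le (H : JumpConcave γ h) (hsR : 1 ≤ sR)
    (hsol : γ sR - sR * deriv γ sR = R) {s : ℝ} (hs : 0 ≤ s) :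
    s * deriv γ sR + γ (1 - s) ≤ γ 1 := by
  have hsR0 : 0 < sR := by linarith
  rcases hs.eq_or_lt with rfl | hs
  · simp
  -- Chords of `h` to the left of `sR` have slope at least `deriv γ sR`. The tangent bound also
  -- covers `sR = 1`, where the three-point inequality is trivial.
  have h1 := H.concave.three_point (show 1 - s ≤ 1 by linarith) hsR
  have h2 := H.sub_rate_le hsR0 hsol (1 - s)
  have h3 := H.le (1 - s)
  rw [← H.eq_of_ne sR hsR0.ne', show γ sR = R + sR * deriv γ sR by linarith] at h1
  rw [H.eq_of_ne 1 one_ne_zero]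
  refine (add_le_add_right h3 _).trans ?_
  refine le_of_mul_le_mul_left (a := sR - 1 + s) ?_ (by linarith)
  nlinarith

end JumpConcave

/-! ### Comparison of the starred values with Forney's values -/

section Values

variable {X Y : Type*} [Fintype X] {P : X → ℝ} {W : X → Y → ℝ}
  {γ h : ℝ → ℝ} {sR R T : ℝ}

theorem sum_eq_exp_neg_gamma (hpos : ∀ y, ∃ x, 0 < P x ∧ 0 < W x y) (hP : ∀ x, 0 ≤ P x)
    (hW : ∀ x y, 0 ≤ W x y) (hγ : ∀ s y, gammaAt P W y s = γ s) (s : ℝ) (y : Y) :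
    ∑ x, P x * W x y ^ s = Real.exp (-γ s) := by
  rw [← hγ s y, gammaAt, neg_neg, Real.exp_log]
  obtain ⟨x, h1, h2⟩ := hpos y
  exact Finset.sum_pos' (fun j _ => mul_nonneg (hP j) (Real.rpow_nonneg (hW j y) _))
      ⟨x, Finset.mem_univ x, mul_pos h1 (Real.rpow_pos_of_pos h2 _)⟩

theorem gamma_le_gamma_one [Nonempty Y]
    (hsum : ∀ s y, ∑ x, P x * W x y ^ s = Real.exp (-γ s))
    (hP : ∀ x, 0 ≤ P x) (hW : ∀ x y, 0 ≤ W x y) (hWle : ∀ x y, W x y ≤ 1) {s : ℝ}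
    (hs1 : s ≤ 1) : γ s ≤ γ 1 := by
  obtain ⟨y⟩ := ‹Nonempty Y›
  have : ∑ x, P x * W x y ^ (1 : ℝ) ≤ ∑ x, P x * W x y ^ s := by
    refine Finset.sum_le_sum fun x _ => mul_le_mul_of_nonneg_left ?_ (hP x)
    exact Real.rpow_le_rpow_of_exponent_ge_of_imp (hW x y) (hWle x y) hs1 (by simp)
  rw [hsum, hsum, Real.exp_le_exp] at this
  linarith

variable [Fintype Y]

theorem forneyE0_eq [Nonempty Y] (hsum : ∀ s y, ∑ x, P x * W x y ^ s = Real.exp (-γ s))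
    (s ρ : ℝ) :
    forneyE0 P W s ρ = γ (1 - s) + ρ * γ (s / ρ) - Real.log (Fintype.card Y) := by
  unfold forneyE0
  simp only [hsum]
  rw [Finset.sum_const, nsmul_eq_mul, Finset.card_univ, ← Real.exp_mul, ← Real.exp_add,
    Real.log_mul (by simp) (Real.exp_pos _).ne', Real.log_exp]
  ring

/-- All output letters have the same probability e^{-γ(1)}, and these add up to 1. -/
theorem gamma_one (hsum : ∀ s y, ∑ x, P x * W x y ^ s = Real.exp (-γ s)) (hP1 : ∑ x, P x = 1)
    (hW1 : ∀ x, ∑ y, W x y = 1) : γ 1 = Real.log (Fintype.card Y) := by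
  have h1 : ∑ y, ∑ x, P x * W x y ^ (1 : ℝ) = 1 := by
    rw [Finset.sum_comm]
    simp [← Finset.mul_sum, hW1, hP1]
  simp only [hsum, Finset.sum_const, nsmul_eq_mul, Finset.card_univ] at h1
  have h2 : (Fintype.card Y : ℝ) = Real.exp (γ 1) := by
    rw [Real.exp_neg] at h1
    have := (Real.exp_pos (γ 1)).ne'
    field_simp at h1
    exact h1
  rw [h2, Real.log_exp]

theorem exists_starValues_ge [Nonempty Y] (H : JumpConcave γ h)
    (hsum : ∀ s y, ∑ x, P x * W x y ^ s = Real.exp (-γ s)) (hsR : 0 ≤ sR)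
    (hsol : γ sR - sR * deriv γ sR = R) (hR : 0 ≤ R) {f : ℝ} (hf : f ∈ forneyValues P W R T) :
    ∃ v ∈ starValues Y γ sR R T, f ≤ v := by
  obtain ⟨s, ρ, hs, hsρ, hρ1, rfl⟩ := hf
  refine ⟨_, ⟨s, hs, rfl⟩, ?_⟩
  rw [forneyE0_eq hsum]
  unfold starAt
  -- At s = 0 both branches of Λ vanish, and Forney's value is the starred one minus ρR.
  rcases hs.eq_or_lt with rfl | hs
  · have : Lam γ sR R 0 = 0 := by
      unfold Lam
      split_ifs with h
      · obtain rfl : sR = 0 := le_antisymm h hsR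
        rw [← hsol]; simp
      · simp
    rw [this, zero_div, H.zero]
    nlinarith
  · have hρ : 0 < ρ := hs.trans_le hsρ
    have := H.mul_sub_rate_le_Lam hsR hsol hρ hρ1 (div_pos hs hρ)
    rw [mul_div_cancel₀ _ hρ.ne'] at this
    linarith

/-- This direction makes the starred supremum finite and achievable through Forney's bound. -/
theorem exists_forneyValues_ge [Nonempty Y] (H : JumpConcave γ h)
    (hγ1 : γ 1 = Real.log (Fintype.card Y))
    (hsum : ∀ s y, ∑ x, P x * W x y ^ s = Real.exp (-γ s))
    (hsol : γ sR - sR * deriv γ sR = R) (hT : 0 ≤ T) {v : ℝ} (hv : v ∈ starValues Y γ sR R T) :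
    ∃ f ∈ forneyValues P W R T, v ≤ f := by
  obtain ⟨s, hs, rfl⟩ := hv
  have hs : 0 ≤ s := hs
  have zero_mem : (0 : ℝ) ∈ forneyValues P W R T :=
    ⟨0, 0, le_rfl, le_rfl, zero_le_one, by rw [forneyE0_eq hsum]; simp [hγ1]⟩
  rcases le_or_gt 1 sR with h1 | h1
  · refine ⟨0, zero_mem, ?_⟩
    have e1 := H.Lam_le (by linarith) hsol s
    have e2 := H.mul_deriv_add_le h1 hsol hs
    have := mul_nonneg hs hT
    unfold starAt
    linarith
  have of_le_one : ∀ u, 0 ≤ u → u ≤ 1 → ∃ f ∈ forneyValues P W R T, starAt Y γ sR R T u ≤ f := by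
    intro u hu hu1
    rcases lt_or_ge u sR with huR | huR
    -- This ρ places s/ρ at the tangency point `sR`; it is admissible because `u < sR < 1`.
    · refine ⟨_, ⟨u, u / sR, hu, ?_, ?_, rfl⟩, ?_⟩
      · rw [le_div_iff₀ (by linarith)]; nlinarith
      · rw [div_le_one (by linarith)]; exact huR.le
      · rw [forneyE0_eq hsum]
        unfold starAt Lam
        rw [if_neg (not_le.2 huR)]
        rcases hu.eq_or_lt with rfl | hu
        · simp
        · rw [div_div_cancel₀ hu.ne']
          have hsR' : sR ≠ 0 := (hu.trans huR).ne'
          have e : deriv γ sR = (γ sR - R) / sR := by field_simp; linarith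
          rw [e]
          apply le_of_eq
          ring
    · refine ⟨_, ⟨u, 1, hu, hu1, le_rfl, rfl⟩, ?_⟩
      rw [forneyE0_eq hsum]
      unfold starAt Lam
      rw [if_pos huR, div_one]
      linarith
  rcases le_or_gt s 1 with hs1 | hs1
  · exact of_le_one s hs hs1
  · have hu1 : max sR (1 / 2) < 1 := max_lt h1 (by norm_num)
    have hu2 : 1 / 2 ≤ max sR (1 / 2) := le_max_right _ _
    obtain ⟨f, hf, hle⟩ := of_le_one (max sR (1 / 2)) (by linarith) hu1.le
    refine ⟨f, hf, le_trans ?_ hle⟩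
    unfold starAt Lam
    rw [if_pos (by linarith), if_pos (le_max_left _ _)]
    have e1 := H.add_reflect_le hu2 hu1 (hu1.trans hs1)
    have e2 := mul_le_mul_of_nonneg_right (hu1.trans hs1).le hT
    linarith

theorem bddAbove_forneyValues [Nonempty Y] (hγ1 : γ 1 = Real.log (Fintype.card Y))
    (hsum : ∀ s y, ∑ x, P x * W x y ^ s = Real.exp (-γ s))
    (hP : ∀ x, 0 ≤ P x) (hW : ∀ x y, 0 ≤ W x y)
    (hWle : ∀ x y, W x y ≤ 1) (hR : 0 ≤ R) (hT : 0 ≤ T) : BddAbove (forneyValues P W R T) := by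
  refine ⟨γ 1, ?_⟩
  rintro _ ⟨s, ρ, hs, hsρ, hρ1, rfl⟩
  have hρ := hs.trans hsρ
  have hγ1' : 0 ≤ γ 1 := by
    rw [hγ1]; exact Real.log_natCast_nonneg _
  rw [forneyE0_eq hsum]
  have e1 := gamma_le_gamma_one hsum hP hW hWle (show 1 - s ≤ 1 by linarith)
  have e2 := gamma_le_gamma_one hsum hP hW hWle (div_le_one_of_le₀ hsρ hρ)
  have e3 : ρ * γ (s / ρ) ≤ γ 1 := (mul_le_mul_of_nonneg_left e2 hρ).trans (by nlinarith)
  have e4 := mul_nonneg hρ hR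
  have e5 := mul_nonneg hs hT
  linarith

end Values
end ErasureCoding
-- Random-coding averages
namespace ErasureCoding

section Ensemble

variable {X Y : Type*} [Fintype X] {P : X → ℝ} {W : X → Y → ℝ} {n M : ℕ}

theorem blockLaw_nonneg {X Y : Type*} {W : X → Y → ℝ} (hW : ∀ x y, 0 ≤ W x y) {n : ℕ}
    (x : Fin n → X) (y : Fin n → Y) : 0 ≤ blockLaw W x y :=
  Finset.prod_nonneg fun _ _ => hW _ _

theorem competitors_nonneg {X Y : Type*} {W : X → Y → ℝ} (hW : ∀ x y, 0 ≤ W x y) {n M : ℕ}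
    (C : Fin M → Fin n → X) (m : Fin M) (y : Fin n → Y) : 0 ≤ competitors W C m y :=
  Finset.sum_nonneg fun _ _ => blockLaw_nonneg hW _ _

theorem sum_codebook_prod (f : Fin M → (Fin n → X) → ℝ) :
    ∑ C : Fin M → Fin n → X, ∏ m, f m (C m) = ∏ m, ∑ x, f m x :=
  (Fintype.prod_sum f).symm

theorem sum_codeword_rpow {Y : Type*} {W : X → Y → ℝ} (hW : ∀ x y, 0 ≤ W x y) (s : ℝ)
    (y : Fin n → Y) :
    ∑ x : Fin n → X, (∏ i, P (x i)) * blockLaw W x y ^ s = ∏ i, ∑ x, P x * W x (y i) ^ s := by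
  rw [Fintype.prod_sum fun i x => P x * W x (y i) ^ s]
  refine Finset.sum_congr rfl fun x _ => ?_
  rw [blockLaw, ← Real.finsetProd_rpow _ _ fun i _ => hW _ _, Finset.prod_mul_distrib]

theorem sum_codeword (hP1 : ∑ x, P x = 1) : ∑ x : Fin n → X, ∏ i, P (x i) = 1 := by
  rw [← Fintype.prod_sum fun _ : Fin n => P]
  simp [hP1]

/-- Marginalization over all codewords but that of message `m`. -/
theorem sum_codebook_mul (hP1 : ∑ x, P x = 1) (m : Fin M) (f : (Fin n → X) → ℝ) :
    ∑ C : Fin M → Fin n → X, (∏ k, ∏ i, P (C k i)) * f (C m)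
      = ∑ x : Fin n → X, (∏ i, P (x i)) * f x := by
  have := sum_codebook_prod (M := M) (n := n) (X := X)
    fun k x => (∏ i, P (x i)) * if k = m then f x else 1
  rw [Fintype.prod_eq_single m fun k hk => by simp [hk, sum_codeword hP1]] at this
  simp only [if_true] at this
  rw [← this]
  refine Finset.sum_congr rfl fun C _ => ?_
  rw [Finset.prod_mul_distrib]
  simp

/-- Distinct codewords are independent. -/
theorem sum_codebook_mul_mul (hP1 : ∑ x, P x = 1) {m m' : Fin M} (hm : m' ≠ m)
    (f g : (Fin n → X) → ℝ) :
    ∑ C : Fin M → Fin n → X, (∏ k, ∏ i, P (C k i)) * f (C m) * g (C m')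
      = (∑ x : Fin n → X, (∏ i, P (x i)) * f x) * ∑ x : Fin n → X, (∏ i, P (x i)) * g x := by
  have := sum_codebook_prod (M := M) (n := n) (X := X)
    fun k x => (∏ i, P (x i)) * (if k = m then f x else 1) * if k = m' then g x else 1
  rw [Fintype.prod_eq_mul m m' hm.symm
    fun k hk => by simp [hk.1, hk.2, sum_codeword hP1]] at this
  simp only [if_true, if_neg hm, if_neg hm.symm, mul_one] at this
  rw [← this]
  refine Finset.sum_congr rfl fun C _ => ?_
  rw [Finset.prod_mul_distrib, Finset.prod_mul_distrib]
  simp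

/-- The mean of `f(𝐱_m) (∑_{m' ≠ m} P(𝐲|𝐱_{m'}))^s`, with `s = ρσ`, by Hölder's inequality and
subadditivity of `t ↦ t^σ`. -/
theorem sum_codebook_competitors_rpow_le (hP : ∀ x, 0 ≤ P x) (hP1 : ∑ x, P x = 1)
    (hW : ∀ x y, 0 ≤ W x y) {ρ σ : ℝ} (hρ : 0 ≤ ρ) (hρ1 : ρ ≤ 1) (hσ : 0 < σ) (hσ1 : σ ≤ 1)
    (m : Fin M) (f : (Fin n → X) → ℝ) (hf : ∀ x, 0 ≤ f x) (y : Fin n → Y) :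
    ∑ C : Fin M → Fin n → X, (∏ k, ∏ i, P (C k i)) * f (C m) * competitors W C m y ^ (ρ * σ)
      ≤ (∑ x : Fin n → X, (∏ i, P (x i)) * f x) *
        (M * ∏ i, ∑ x, P x * W x (y i) ^ σ) ^ ρ := by
  set F := ∑ x : Fin n → X, (∏ i, P (x i)) * f x with hF
  set G := ∏ i, ∑ x, P x * W x (y i) ^ σ with hG
  have hG0 : 0 ≤ G := Finset.prod_nonneg fun i _ => Finset.sum_nonneg fun x _ =>
    mul_nonneg (hP x) (Real.rpow_nonneg (hW _ _) _)
  have hw : ∀ C : Fin M → Fin n → X, 0 ≤ (∏ k, ∏ i, P (C k i)) * f (C m) := fun C =>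
    mul_nonneg (Finset.prod_nonneg fun k _ => Finset.prod_nonneg fun i _ => hP _) (hf _)
  have hF0 : 0 ≤ F :=
    Finset.sum_nonneg fun x _ => mul_nonneg (Finset.prod_nonneg fun i _ => hP _) (hf _)
  have hS := fun C : Fin M → Fin n → X => competitors_nonneg hW C m y
  -- Hölder is applied to the weights and to the weights times the σ-th power, so it acts as
  -- Jensen's inequality for t ↦ t^ρ.
  have key := sum_rpow_mul_rpow_le Finset.univ
    (fun C : Fin M → Fin n → X => (∏ k, ∏ i, P (C k i)) * f (C m))
    (fun C => (∏ k, ∏ i, P (C k i)) * f (C m) * competitors W C m y ^ σ)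
    (fun C _ => hw C) (fun C _ => mul_nonneg (hw C) (Real.rpow_nonneg (hS C) _)) hρ hρ1
  have e : ∀ C : Fin M → Fin n → X, ((∏ k, ∏ i, P (C k i)) * f (C m)) ^ (1 - ρ) *
      ((∏ k, ∏ i, P (C k i)) * f (C m) * competitors W C m y ^ σ) ^ ρ =
      (∏ k, ∏ i, P (C k i)) * f (C m) * competitors W C m y ^ (ρ * σ) := fun C => by
    rw [Real.mul_rpow (hw C) (Real.rpow_nonneg (hS C) _), ← Real.rpow_mul (hS C), ← mul_assoc,
      ← Real.rpow_add' (hw C) (by simp), sub_add_cancel, Real.rpow_one, mul_comm σ]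
  simp only [e, sum_codebook_mul hP1] at key
  have key2 : ∑ C : Fin M → Fin n → X,
      (∏ k, ∏ i, P (C k i)) * f (C m) * competitors W C m y ^ σ ≤ F * (M * G) := by
    calc _ ≤ ∑ C : Fin M → Fin n → X, ∑ m' ∈ Finset.univ.erase m,
          (∏ k, ∏ i, P (C k i)) * f (C m) * blockLaw W (C m') y ^ σ := by
          refine Finset.sum_le_sum fun C _ => ?_
          rw [← Finset.mul_sum]
          exact mul_le_mul_of_nonneg_left (rpow_sum_le_sum_rpow _ _
            (fun k _ => blockLaw_nonneg hW _ _) hσ hσ1) (hw C)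
      _ = ∑ m' ∈ Finset.univ.erase m, F * G := by
          rw [Finset.sum_comm]
          refine Finset.sum_congr rfl fun m' hm' => ?_
          rw [sum_codebook_mul_mul hP1 (Finset.ne_of_mem_erase hm') f
            fun x => blockLaw W x y ^ σ, sum_codeword_rpow hW]
      _ ≤ _ := by
          rw [Finset.sum_const, nsmul_eq_mul]
          have : ((Finset.univ.erase m).card : ℝ) ≤ M := by
            exact_mod_cast (Finset.card_le_univ _).trans_eq (Fintype.card_fin M)
          have := mul_le_mul_of_nonneg_right this (mul_nonneg hF0 hG0)
          linarith
  refine key.trans ?_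
  rw [← hF]
  calc _ ≤ F ^ (1 - ρ) * (F * (M * G)) ^ ρ := by
        refine mul_le_mul_of_nonneg_left (Real.rpow_le_rpow ?_ key2 hρ)
          (Real.rpow_nonneg hF0 _)
        exact Finset.sum_nonneg fun C _ => mul_nonneg (hw C) (Real.rpow_nonneg (hS C) _)
    _ = _ := by
        rw [Real.mul_rpow hF0 (by positivity), ← mul_assoc, ← Real.rpow_add' hF0 (by simp),
          sub_add_cancel, Real.rpow_one]

/-- Off the region the ratio of e^{nT} times the competitors to the likelihood exceeds 1, so its
s-th power may be inserted. -/
theorem indicator_compl_decisionRegion_le {X Y : Type*} {W : X → Y → ℝ}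
    (hW : ∀ x y, 0 ≤ W x y) {n M : ℕ} (T : ℝ) {s : ℝ} (hs : 0 ≤ s)
    (C : Fin M → Fin n → X) (m : Fin M) (y : Fin n → Y) :
    (decisionRegion W T C m)ᶜ.indicator (blockLaw W (C m)) y ≤
      Real.exp (n * T * s) * (blockLaw W (C m) y ^ (1 - s) * competitors W C m y ^ s) := by
  have hp := blockLaw_nonneg hW (C m) y
  have hS := competitors_nonneg hW C m y
  by_cases hy : y ∈ (decisionRegion W T C m)ᶜ
  · rw [Set.indicator_of_mem hy]
    have hlt : blockLaw W (C m) y ≤ Real.exp (n * T) * competitors W C m y :=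
      (not_le.1 (show ¬ Real.exp (n * T) * competitors W C m y ≤ blockLaw W (C m) y from hy)).le
    calc blockLaw W (C m) y = blockLaw W (C m) y ^ (1 - s) * blockLaw W (C m) y ^ s := by
          rw [← Real.rpow_add' hp (by simp), sub_add_cancel, Real.rpow_one]
      _ ≤ blockLaw W (C m) y ^ (1 - s) * (Real.exp (n * T) * competitors W C m y) ^ s :=
          mul_le_mul_of_nonneg_left (Real.rpow_le_rpow hp hlt hs) (Real.rpow_nonneg hp _)
      _ = _ := by
          rw [Real.mul_rpow (Real.exp_pos _).le hS, ← Real.exp_mul]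
          ring
  · rw [Set.indicator_of_notMem hy]
    positivity

/-- On the region the competitors are at most e^{-nT} times the likelihood. Raising this to the
power 1-s gives the previous bound times e^{-nT}, the source of E₂* = E₁* + T. -/
theorem indicator_decisionRegion_le {X Y : Type*} {W : X → Y → ℝ} (hW : ∀ x y, 0 ≤ W x y)
    {n M : ℕ} (T : ℝ) {s : ℝ} (hs1 : s ≤ 1) (C : Fin M → Fin n → X) (m : Fin M) (y : Fin n → Y) :
    (decisionRegion W T C m).indicator (competitors W C m) y ≤
      Real.exp (-(n * T)) *
        (Real.exp (n * T * s) * (blockLaw W (C m) y ^ (1 - s) * competitors W C m y ^ s)) := by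
  have hp := blockLaw_nonneg hW (C m) y
  have hS := competitors_nonneg hW C m y
  by_cases hy : y ∈ decisionRegion W T C m
  · rw [Set.indicator_of_mem hy]
    have hle : competitors W C m y ≤ Real.exp (-(n * T)) * blockLaw W (C m) y := by
      have : Real.exp (n * T) * competitors W C m y ≤ blockLaw W (C m) y := hy
      calc competitors W C m y
          = Real.exp (-(n * T)) * (Real.exp (n * T) * competitors W C m y) := by
            rw [← mul_assoc, ← Real.exp_add]; simp
        _ ≤ _ := mul_le_mul_of_nonneg_left this (Real.exp_pos _).le
    calc competitors W C m y = competitors W C m y ^ (1 - s) * competitors W C m y ^ s := by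
          rw [← Real.rpow_add' hS (by simp), sub_add_cancel, Real.rpow_one]
      _ ≤ (Real.exp (-(n * T)) * blockLaw W (C m) y) ^ (1 - s) * competitors W C m y ^ s :=
          mul_le_mul_of_nonneg_right (Real.rpow_le_rpow hS hle (by linarith))
            (Real.rpow_nonneg hS _)
      _ = _ := by
          rw [Real.mul_rpow (Real.exp_pos _).le hp, ← Real.exp_mul, ← mul_assoc, ← mul_assoc,
            ← Real.exp_add]
          ring_nf
  · rw [Set.indicator_of_notMem hy]
    positivity

variable [Fintype Y]

/-- A bound on the average of an error functional from a bound on its summands. -/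
theorem codeAverage_le (hP : ∀ x, 0 ≤ P x) (φ : (Fin M → Fin n → X) → Fin M → (Fin n → Y) → ℝ)
    (B : (Fin M → Fin n → X) → Fin M → (Fin n → Y) → ℝ) (hφ : ∀ C m y, φ C m y ≤ B C m y)
    {b : ℝ} (hM : 1 ≤ M)
    (hB : ∀ m, ∑ y, ∑ C : Fin M → Fin n → X, (∏ k, ∏ i, P (C k i)) * B C m y ≤ b) :
    codeAverage P (fun C : Fin M → Fin n → X => (1 / (M : ℝ)) * ∑ m, ∑ y, φ C m y) ≤ b := by
  have hM0 : (0 : ℝ) < M := by exact_mod_cast hM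
  calc _ ≤ ∑ C : Fin M → Fin n → X, (∏ k, ∏ i, P (C k i)) *
        ((1 / (M : ℝ)) * ∑ m, ∑ y, B C m y) := by
        refine Finset.sum_le_sum fun C _ => mul_le_mul_of_nonneg_left ?_
          (Finset.prod_nonneg fun k _ => Finset.prod_nonneg fun i _ => hP _)
        refine mul_le_mul_of_nonneg_left ?_ (by positivity)
        exact Finset.sum_le_sum fun m _ => Finset.sum_le_sum fun y _ => hφ C m y
    _ = (1 / (M : ℝ)) * ∑ m, ∑ y, ∑ C : Fin M → Fin n → X, (∏ k, ∏ i, P (C k i)) * B C m y := by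
        simp only [Finset.mul_sum]
        rw [Finset.sum_comm]
        refine Finset.sum_congr rfl fun m _ => ?_
        rw [Finset.sum_comm]
        refine Finset.sum_congr rfl fun y _ => Finset.sum_congr rfl fun C _ => ?_
        ring
    _ ≤ (1 / (M : ℝ)) * ∑ _m : Fin M, b := by
        gcongr with m
        exact hB m
    _ = b := by
        rw [Finset.sum_const, nsmul_eq_mul, Finset.card_univ, Fintype.card_fin]
        field_simp

variable {γ : ℝ → ℝ}

/-- The exponent is that of Forney's bound at `(ρσ, ρ)`. -/
theorem sum_error_bound_le [Nonempty Y] (hP : ∀ x, 0 ≤ P x) (hP1 : ∑ x, P x = 1)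
    (hW : ∀ x y, 0 ≤ W x y) (hsum : ∀ s y, ∑ x, P x * W x y ^ s = Real.exp (-γ s)) (T : ℝ)
    {ρ σ : ℝ} (hρ : 0 < ρ) (hρ1 : ρ ≤ 1) (hσ : 0 < σ) (hσ1 : σ ≤ 1) (hM : 1 ≤ M) (m : Fin M) :
    ∑ y : Fin n → Y, ∑ C : Fin M → Fin n → X, (∏ k, ∏ i, P (C k i)) *
        (Real.exp (n * T * (ρ * σ)) *
          (blockLaw W (C m) y ^ (1 - ρ * σ) * competitors W C m y ^ (ρ * σ)))
      ≤ Real.exp (ρ * Real.log M - n * (forneyE0 P W (ρ * σ) ρ - ρ * σ * T)) := by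
  have hM0 : (0 : ℝ) < M := by exact_mod_cast hM
  have hone : ∀ y : Fin n → Y, ∑ C : Fin M → Fin n → X, (∏ k, ∏ i, P (C k i)) *
        (Real.exp (n * T * (ρ * σ)) *
          (blockLaw W (C m) y ^ (1 - ρ * σ) * competitors W C m y ^ (ρ * σ))) ≤
      Real.exp (n * T * (ρ * σ) - n * γ (1 - ρ * σ) + ρ * (Real.log M - n * γ σ)) := by
    intro y
    have := sum_codebook_competitors_rpow_le hP hP1 hW hρ.le hρ1 hσ hσ1 m
      (fun x => blockLaw W x y ^ (1 - ρ * σ))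
      (fun x => Real.rpow_nonneg (blockLaw_nonneg hW _ _) _) y
    rw [sum_codeword_rpow hW] at this
    simp only [hsum, Finset.prod_const, Finset.card_univ, Fintype.card_fin] at this
    calc _ = Real.exp (n * T * (ρ * σ)) * ∑ C : Fin M → Fin n → X, (∏ k, ∏ i, P (C k i)) *
          blockLaw W (C m) y ^ (1 - ρ * σ) * competitors W C m y ^ (ρ * σ) := by
          rw [Finset.mul_sum]
          refine Finset.sum_congr rfl fun C _ => ?_
          ring
      _ ≤ _ := mul_le_mul_of_nonneg_left this (Real.exp_pos _).le
      _ = _ := by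
          nth_rw 1 [← Real.exp_log hM0]
          rw [← Real.exp_nat_mul, ← Real.exp_nat_mul, ← Real.exp_add, ← Real.exp_mul,
            ← Real.exp_add, ← Real.exp_add]
          ring_nf
  have hY : (0 : ℝ) < Fintype.card Y := by exact_mod_cast Fintype.card_pos
  calc _ ≤ ∑ y : Fin n → Y, _ := Finset.sum_le_sum fun y _ => hone y
    _ = _ := by
      rw [Finset.sum_const, nsmul_eq_mul, Finset.card_univ, Fintype.card_fun, Fintype.card_fin,
        forneyE0_eq hsum, mul_div_cancel_left₀ _ hρ.ne']
      push_cast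
      nth_rw 1 [← Real.exp_log hY]
      rw [← Real.exp_nat_mul, ← Real.exp_add]
      ring_nf

/-- At `s = 0` the error functionals are bounded by total probabilities. -/
theorem sum_blockLaw_codeword (hP1 : ∑ x, P x = 1) (hW1 : ∀ x, ∑ y, W x y = 1) (m : Fin M) :
    ∑ y : Fin n → Y, ∑ C : Fin M → Fin n → X, (∏ k, ∏ i, P (C k i)) * blockLaw W (C m) y = 1 := by
  rw [Finset.sum_comm]
  have : ∀ x : Fin n → X, ∑ y : Fin n → Y, blockLaw W x y = 1 := fun x => by
    unfold blockLaw
    rw [← Fintype.prod_sum fun i y => W (x i) y]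
    simp [hW1]
  simp only [← Finset.mul_sum, this]
  rw [sum_codebook_mul hP1 m fun _ => 1]
  simp [sum_codeword hP1]

end Ensemble
end ErasureCoding
-- Passage to exponential rates
namespace ErasureCoding

section Rates

variable {X Y : Type*} [Fintype X] [Fintype Y] {P : X → ℝ} {W : X → Y → ℝ} {γ : ℝ → ℝ}

theorem codeAverage_prE_le {n M : ℕ} (hP : ∀ x, 0 ≤ P x) (hW : ∀ x y, 0 ≤ W x y) (hM : 1 ≤ M)
    (T : ℝ) {s b : ℝ} (hs : 0 ≤ s) (hs1 : s ≤ 1)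
    (hb : ∀ m : Fin M, ∑ y : Fin n → Y, ∑ C : Fin M → Fin n → X, (∏ k, ∏ i, P (C k i)) *
      (Real.exp (n * T * s) * (blockLaw W (C m) y ^ (1 - s) * competitors W C m y ^ s)) ≤ b) :
    codeAverage (n := n) (M := M) P (prE1 W T) ≤ b ∧
      codeAverage (n := n) (M := M) P (prE2 W T) ≤ Real.exp (-(n * T)) * b := by
  refine ⟨codeAverage_le hP _ _
      (fun C m y => indicator_compl_decisionRegion_le hW T hs C m y) hM hb,
    codeAverage_le hP _ _
      (fun C m y => indicator_decisionRegion_le hW T hs1 C m y) hM fun m => ?_⟩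
  refine le_trans (le_of_eq ?_) (mul_le_mul_of_nonneg_left (hb m) (Real.exp_pos _).le)
  rw [Finset.mul_sum]
  refine Finset.sum_congr rfl fun y _ => ?_
  rw [Finset.mul_sum]
  exact Finset.sum_congr rfl fun C _ => by ring

/-- The ensemble achieves every value of Forney's bound, for both error probabilities. -/
theorem eventually_codeAverage_prE_le [Nonempty Y] (hP : ∀ x, 0 ≤ P x) (hP1 : ∑ x, P x = 1)
    (hW : ∀ x y, 0 ≤ W x y) (hW1 : ∀ x, ∑ y, W x y = 1)
    (hsum : ∀ s y, ∑ x, P x * W x y ^ s = Real.exp (-γ s)) (hγ0 : γ 0 = 0)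
    (hγ1 : γ 1 = Real.log (Fintype.card Y)) {R T : ℝ} (hR : 0 ≤ R) {M : ℕ → ℕ}
    (hM : ∀ n, 1 ≤ M n) (hrate : Tendsto (fun n : ℕ => Real.log (M n) / n) atTop (𝓝 R))
    {f : ℝ} (hf : f ∈ forneyValues P W R T) {ε : ℝ} (hε : 0 < ε) :
    ∀ᶠ n : ℕ in atTop,
      codeAverage (n := n) (M := M n) P (prE1 W T) ≤ Real.exp (-(n * (f - ε))) ∧
      codeAverage (n := n) (M := M n) P (prE2 W T) ≤ Real.exp (-(n * (f + T - ε))) := by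
  suffices h : ∀ᶠ n : ℕ in atTop, ∃ s b : ℝ, 0 ≤ s ∧ s ≤ 1 ∧ b ≤ Real.exp (-(n * (f - ε))) ∧
      ∀ m : Fin (M n), ∑ y : Fin n → Y, ∑ C : Fin (M n) → Fin n → X, (∏ k, ∏ i, P (C k i)) *
        (Real.exp (n * T * s) *
          (blockLaw W (C m) y ^ (1 - s) * competitors W C m y ^ s)) ≤ b by
    filter_upwards [h] with n ⟨s, b, hs, hs1, hb, hsum⟩
    obtain ⟨h1, h2⟩ := codeAverage_prE_le hP hW (hM n) T hs hs1 hsum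
    refine ⟨h1.trans hb, h2.trans ?_⟩
    refine (mul_le_mul_of_nonneg_left hb (Real.exp_pos _).le).trans_eq ?_
    rw [← Real.exp_add]
    ring_nf
  obtain ⟨s, ρ, hs, hsρ, hρ1, rfl⟩ := hf
  rcases hs.eq_or_lt with rfl | hs
  -- At s = 0 Forney's value is -ρR ≤ 0, so total probability 1 is a sufficient bound.
  · refine Eventually.of_forall fun n => ⟨0, 1, le_rfl, zero_le_one, ?_, fun m => ?_⟩
    · rw [Real.one_le_exp_iff, forneyE0_eq hsum]
      simp only [sub_zero, zero_div, hγ0, mul_zero, add_zero, hγ1, sub_self, zero_mul]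
      have := mul_nonneg hsρ hR
      rw [← mul_neg]
      exact mul_nonneg n.cast_nonneg (by linarith)
    · simp [sum_blockLaw_codeword hP1 hW1]
  · have hρ : 0 < ρ := hs.trans_le hsρ
    filter_upwards [hrate.eventually (gt_mem_nhds (show R < R + ε by linarith)),
      eventually_gt_atTop 0] with n hn hn0
    have hn0 : (0 : ℝ) < n := by exact_mod_cast hn0
    refine ⟨s, Real.exp (ρ * Real.log (M n) - n * (forneyE0 P W s ρ - s * T)), hs.le,
      hsρ.trans hρ1, ?_, fun m => ?_⟩
    · rw [Real.exp_le_exp]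
      rw [div_lt_iff₀ hn0] at hn
      have e1 := mul_le_mul_of_nonneg_left hn.le hρ.le
      -- The rate enters multiplied by ρ ≤ 1, so an excess ε in rate costs at most ε in exponent.
      have e2 : ρ * (ε * n) ≤ 1 * (ε * n) := mul_le_mul_of_nonneg_right hρ1 (by positivity)
      nlinarith
    · have := sum_error_bound_le hP hP1 hW hsum T hρ hρ1 (div_pos hs hρ)
        ((div_le_one hρ).2 hsρ) (hM n) m (n := n)
      rwa [mul_div_cancel₀ _ hρ.ne'] at this

theorem ExpLE.of_forall_eventually_le {a : ℕ → ℝ} {E : ℝ}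
    (h : ∀ ε > 0, ∀ᶠ n : ℕ in atTop, a n ≤ Real.exp (-(n * (E - ε)))) :
    ExpLE a fun n => Real.exp (-(n * E)) := by
  unfold ExpLE
  refine EReal.le_of_forall_lt_iff_le.1 fun ε hε => ?_
  have hε : 0 < ε := by exact_mod_cast hε
  refine limsup_le_of_le (h := ?_)
  filter_upwards [h ε hε, eventually_gt_atTop 0] with n hn hn0
  have hn0 : (0 : ℝ) < n := by exact_mod_cast hn0
  have h1 : a n / Real.exp (-(n * E)) ≤ Real.exp (n * ε) := by
    rw [div_le_iff₀ (Real.exp_pos _), ← Real.exp_add]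
    exact hn.trans_eq (by ring_nf)
  have h2 : ENNReal.log (ENNReal.ofReal (a n / Real.exp (-(n * E)))) ≤ ((n * ε : ℝ) : EReal) := by
    refine (ENNReal.log_monotone (ENNReal.ofReal_le_ofReal h1)).trans_eq ?_
    rw [ENNReal.log_ofReal_of_pos (Real.exp_pos _), Real.log_exp]
  refine (mul_le_mul_of_nonneg_left h2 ?_).trans_eq ?_
  · exact_mod_cast (by positivity : (0 : ℝ) ≤ 1 / n)
  · rw [← EReal.coe_mul]
    congr 1
    field_simp

end Rates

end ErasureCoding

/-! ### The main theorem -/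

theorem theorem1 {X Y : Type*} [Fintype X] [Fintype Y]
    -- random-coding distribution and channel transition matrix `W x y = P(y|x)`
    (P : X → ℝ) (hP : P ∈ stdSimplex ℝ X)
    (W : X → Y → ℝ) (hW : ∀ x, W x ∈ stdSimplex ℝ Y)
    -- every output letter has positive probability, so that the logarithms below are finite
    (hpos : ∀ y, ∃ x, 0 < P x ∧ 0 < W x y)
    -- `γ_y(s)` does not depend on `y`
    (γ : ℝ → ℝ) (hγ : ∀ (s : ℝ) (y : Y), ErasureCoding.gammaAt P W y s = γ s)
    (R T : ℝ) (hR : 0 ≤ R) (hT : 0 ≤ T)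
    -- `sR` is the (nonnegative) solution of `γ(s) - s γ'(s) = R`
    (sR : ℝ) (hsR : 0 ≤ sR) (hsol : γ sR - sR * deriv γ sR = R)
    -- code sizes `M = e^{nR}`, up to rounding and subexponential factors
    (M : ℕ → ℕ) (hM : ∀ n, 1 ≤ M n)
    (hrate : Filter.Tendsto (fun n : ℕ => Real.log (M n) / n) Filter.atTop (nhds R)) :
    -- the suprema defining the two exponents are finite
    BddAbove (ErasureCoding.starValues Y γ sR R T) ∧
    BddAbove (ErasureCoding.forneyValues P W R T) ∧
    ErasureCoding.ExpLE
      (fun n => ErasureCoding.codeAverage (n := n) (M := M n) P (ErasureCoding.prE1 W T))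
      (fun n => Real.exp (-(n * ErasureCoding.starE1 Y γ sR R T))) ∧
    ErasureCoding.ExpLE
      (fun n => ErasureCoding.codeAverage (n := n) (M := M n) P (ErasureCoding.prE2 W T))
      (fun n => Real.exp (-(n * ErasureCoding.starE2 Y γ sR R T))) ∧
    ErasureCoding.forneyE1 P W R T ≤ ErasureCoding.starE1 Y γ sR R T := by
  have hP0 : ∀ x, 0 ≤ P x := hP.1
  have hP1 : ∑ x, P x = 1 := hP.2
  have hW0 : ∀ x y, 0 ≤ W x y := fun x => (hW x).1
  have hW1 : ∀ x, ∑ y, W x y = 1 := fun x => (hW x).2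
  have hWle : ∀ x y, W x y ≤ 1 := fun x y =>
    hW1 x ▸ Finset.single_le_sum (fun z _ => hW0 x z) (Finset.mem_univ y)
  have hX : Nonempty X := by
    by_contra hne
    rw [not_nonempty_iff] at hne
    simp at hP1
  have hY : Nonempty Y := by
    by_contra hne
    rw [not_nonempty_iff] at hne
    simpa using hW1 hX.some
  have hsum := ErasureCoding.sum_eq_exp_neg_gamma hpos hP0 hW0 hγ
  have hγ1 := ErasureCoding.gamma_one hsum hP1 hW1
  have hγ0 : γ 0 = 0 := by
    rw [← hγ 0 hY.some, ErasureCoding.gammaAt]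
    simp [hP1]
  obtain ⟨h, hc, hd, heq, h0⟩ :=
    ErasureCoding.exists_concave_eq_gammaAt P hP0 hP1 W hW0 hY.some (hpos _)
  have H : ErasureCoding.JumpConcave γ h :=
    ⟨hc, hd, fun s hs => by rw [← hγ s hY.some, heq s hs], h0, hγ0⟩
  have hbF := ErasureCoding.bddAbove_forneyValues hγ1 hsum hP0 hW0 hWle hR hT
  have hFS : ∀ v ∈ ErasureCoding.starValues Y γ sR R T,
      ∃ f ∈ ErasureCoding.forneyValues P W R T, v ≤ f := fun v hv =>
    ErasureCoding.exists_forneyValues_ge H hγ1 hsum hsol hT hv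
  have hbS : BddAbove (ErasureCoding.starValues Y γ sR R T) := by
    obtain ⟨b, hb⟩ := hbF
    refine ⟨b, fun v hv => ?_⟩
    obtain ⟨f, hf, hvf⟩ := hFS v hv
    exact hvf.trans (hb hf)
  have hne : (ErasureCoding.starValues Y γ sR R T).Nonempty := ⟨_, 0, Set.mem_Ici.2 le_rfl, rfl⟩
  have hev : ∀ ε > 0, ∀ᶠ n : ℕ in atTop,
      ErasureCoding.codeAverage (n := n) (M := M n) P (ErasureCoding.prE1 W T) ≤
        Real.exp (-(n * (ErasureCoding.starE1 Y γ sR R T - ε))) ∧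
      ErasureCoding.codeAverage (n := n) (M := M n) P (ErasureCoding.prE2 W T) ≤
        Real.exp (-(n * (ErasureCoding.starE2 Y γ sR R T - ε))) := by
    intro ε hε
    -- Half of ε pays for approximating the supremum, the other half for the convergence of the
    -- rate.
    obtain ⟨v, hv, hlt⟩ := exists_lt_of_lt_csSup hne
      (show ErasureCoding.starE1 Y γ sR R T - ε / 2 < _ from sub_lt_self _ (half_pos hε))
    obtain ⟨f, hf, hvf⟩ := hFS v hv
    filter_upwards [ErasureCoding.eventually_codeAverage_prE_le hP0 hP1 hW0 hW1 hsum hγ0 hγ1 hR hM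
      hrate hf (half_pos hε)] with n ⟨h1, h2⟩
    refine ⟨h1.trans ?_, h2.trans ?_⟩ <;> rw [Real.exp_le_exp, neg_le_neg_iff] <;>
      refine mul_le_mul_of_nonneg_left ?_ n.cast_nonneg
    · linarith
    · unfold ErasureCoding.starE2
      linarith
  refine ⟨hbS, hbF, .of_forall_eventually_le fun ε hε => (hev ε hε).mono fun n hn => hn.1,
    .of_forall_eventually_le fun ε hε => (hev ε hε).mono fun n hn => hn.2, ?_⟩
  refine csSup_le ⟨_, 0, 0, le_rfl, le_rfl, zero_le_one, rfl⟩ fun f hf => ?_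
  obtain ⟨v, hv, hfv⟩ := ErasureCoding.exists_starValues_ge H hsum hsR hsol hR hf
  exact hfv.trans (le_csSup hbS hv)
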